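/- Let $q,\rho\in\mathbb{R}$ with $|q|<1$, $|\rho|<1$, and let $x\in S(q)=[-2/\sqrt{1-q},\,2/\sqrt{1-q}]$. Write $(a)_\infty=\prod_{j\ge 0}(1-aq^j)$, $[n]_q=1+q+\dots+q^{n-1}$ and $[n]_q!=\prod_{j=1}^n[j]_q$ (so $[0]_q!=1$). Let $H_n(x|q)=(1-q)^{-n/2}\,h_n\!\left(\tfrac{x\sqrt{1-q}}{2}\,\middle|\,q\right)$, where the continuous $q$-Hermite polynomials $h_n$ are given by $h_{-1}(x|q)=0$, $h_0(x|q)=1$ and $2x\,h_n(x|q)=h_{n+1}(x|q)+(1-q^n)h_{n-1}(x|q)$ for $n\ge 0$. Finally let $L_q(x|a)=(1+a)^2-(1-q)x^2a$. Then $(\rho)_\infty\neq 0$, $L_q(x|\rho q^k)\ne 0$ for every $k\ge 0$, the infinite product and the series below converge (unconditionally), and $$\sum_{k\ge 0}\frac{\rho^k(\rho q^{k+1})_\infty}{[k]_q!}\,H_{2k}(x|q)=\frac{(\rho^2)_\infty}{(\rho)_\infty}\prod_{k=0}^{\infty}L_q^{-1}(x|\rho q^k).$$ -/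

import Mathlib

/-- The infinite `q`-Pochhammer symbol `(a; q)_∞ = ∏_{j ≥ 0} (1 - a q^j)`. -/
noncomputable def qPochInf (a q : ℝ) : ℝ := ∏' j : ℕ, (1 - a * q ^ j)

/-- For `|q| < 1` the infinite product defining `(a; q)_∞` converges. -/
theorem multipliable_qPochInf (a : ℝ) {q : ℝ} (hq : |q| < 1) :
    Multipliable (fun j : ℕ => 1 - a * q ^ j) := by
  have hs : Summable (fun j : ℕ => ‖-(a * q ^ j)‖) := by
    have h := (summable_geometric_of_lt_one (abs_nonneg q) hq).mul_left |a|
    refine h.congr fun j => ?_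
    simp [abs_mul, abs_pow]
  refine (multipliable_one_add_of_summable hs).congr fun j => ?_
  ring

/-- The `q`-number `[n]_q = 1 + q + ⋯ + q^(n-1)`, with `[0]_q = 0`. -/
noncomputable def qNumber (q : ℝ) (n : ℕ) : ℝ := ∑ i ∈ Finset.range n, q ^ i

/-- The `q`-factorial `[n]_q! = [1]_q [2]_q ⋯ [n]_q`, with `[0]_q! = 1`. -/
noncomputable def qFact (q : ℝ) (n : ℕ) : ℝ := ∏ j ∈ Finset.range n, qNumber q (j + 1)

/-- The continuous `q`-Hermite polynomials `h_n(x|q)`: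
`h_0 = 1`, `h_1 = 2x` and `h_{n+1} = 2x h_n - (1 - q^n) h_{n-1}` for `n ≥ 1`. -/
noncomputable def qHermiteCont (q x : ℝ) : ℕ → ℝ
  | 0 => 1
  | 1 => 2 * x
  | n + 2 => 2 * x * qHermiteCont q x (n + 1) - (1 - q ^ (n + 1)) * qHermiteCont q x n

/-- The rescaled (monic) `q`-Hermite polynomials
`H_n(x|q) = (1-q)^(-n/2) h_n(x √(1-q) / 2 | q)`, for `q < 1`. -/
noncomputable def qHermite (q : ℝ) (n : ℕ) (x : ℝ) : ℝ :=
  (1 - q) ^ (-(n : ℝ) / 2) * qHermiteCont q (x * Real.sqrt (1 - q) / 2) n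

/-- The support interval `S(q) = [-2/√(1-q), 2/√(1-q)]`. -/
noncomputable def supportS (q : ℝ) : Set ℝ :=
  Set.Icc (-2 / Real.sqrt (1 - q)) (2 / Real.sqrt (1 - q))

/-- `l(x|a) = (1+a)^2 - 4 x^2 a`. -/
def lFactor (x a : ℝ) : ℝ := (1 + a) ^ 2 - 4 * x ^ 2 * a

/-- `L_q(x|a) = l(x √(1-q) / 2 | a)`, which for `q ≤ 1` is `(1+a)^2 - (1-q) x^2 a`. -/
noncomputable def LFactor (q x a : ℝ) : ℝ := lFactor (x * Real.sqrt (1 - q) / 2) a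

/-! With y = x√(1-q)/2, put F(a) = ∑ a^k (aq^(k+1))_∞ h_{2k}(y|q) / (q)_k, where (q)_k =
(1-q)⋯(1-q^k). The three-term recurrence gives l(y|a) F(a) = (1+a)(1-qa²) F(aq)
(`lFactor_mul_tsum_evenTerm`). Iterating n times turns F(a) into F(aq^n) and builds up ∏ l(y|aq^k),
(a)_n and (a²)_{2n}; since F(aq^n) → 1, the product formula is the limit (`tsum_evenTerm`). All
convergence rests on |y| ≤ 1, where h_n grows at most linearly in n (`exists_abs_qHermiteCont_le`),
so the terms are dominated by C(k+1)|a|^k. -/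

open Filter Topology

/-! ### q-Pochhammer symbols -/

/-- The finite `q`-Pochhammer symbol `(a; q)_n`. -/
noncomputable def qPochFin (a q : ℝ) (n : ℕ) : ℝ := ∏ j ∈ Finset.range n, (1 - a * q ^ j)

theorem qPochFin_succ (a q : ℝ) (n : ℕ) :
    qPochFin a q (n + 1) = qPochFin a q n * (1 - a * q ^ n) :=
  Finset.prod_range_succ _ _

theorem abs_mul_pow_le {q : ℝ} (hq : |q| < 1) (a : ℝ) (n : ℕ) : |a * q ^ n| ≤ |a| := by
  rw [abs_mul, abs_pow]
  exact mul_le_of_le_one_right (abs_nonneg a) (pow_le_one₀ (abs_nonneg q) hq.le)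

theorem abs_mul_pow_lt_one {a q : ℝ} (hq : |q| < 1) (ha : |a| < 1) (n : ℕ) : |a * q ^ n| < 1 :=
  (abs_mul_pow_le hq a n).trans_lt ha

theorem one_sub_ne_zero_of_abs_lt_one {t : ℝ} (ht : |t| < 1) : 1 - t ≠ 0 := by
  have := (abs_lt.mp ht).2
  linarith

theorem qPochFin_ne_zero {a q : ℝ} (hq : |q| < 1) (ha : |a| < 1) (n : ℕ) : qPochFin a q n ≠ 0 :=
  Finset.prod_ne_zero_iff.mpr fun j _ => one_sub_ne_zero_of_abs_lt_one (abs_mul_pow_lt_one hq ha j)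

theorem summable_abs_mul_pow (a : ℝ) {q : ℝ} (hq : |q| < 1) :
    Summable (fun j : ℕ => |a * q ^ j|) := by
  refine ((summable_geometric_of_lt_one (abs_nonneg q) hq).mul_left |a|).congr fun j => ?_
  rw [abs_mul, abs_pow]

theorem tendsto_qPochFin (a : ℝ) {q : ℝ} (hq : |q| < 1) :
    Tendsto (qPochFin a q) atTop (𝓝 (qPochInf a q)) :=
  (multipliable_qPochInf a hq).hasProd.tendsto_prod_nat

theorem qPochInf_ne_zero {a q : ℝ} (hq : |q| < 1) (ha : |a| < 1) : qPochInf a q ≠ 0 := by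
  have h := tprod_one_add_ne_zero_of_summable (f := fun j : ℕ => -(a * q ^ j))
    (fun j => by
      rw [← sub_eq_add_neg]
      exact one_sub_ne_zero_of_abs_lt_one (abs_mul_pow_lt_one hq ha j))
    ((summable_abs_mul_pow a hq).congr fun j => by rw [Real.norm_eq_abs, abs_neg])
  simpa only [qPochInf, sub_eq_add_neg] using h

theorem qPochFin_succ' (a q : ℝ) (n : ℕ) :
    qPochFin a q (n + 1) = (1 - a) * qPochFin (a * q) q n := by
  rw [qPochFin, Finset.prod_range_succ', mul_comm, qPochFin, pow_zero, mul_one]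
  congr 1
  exact Finset.prod_congr rfl fun j _ => by ring

theorem qPochInf_eq_mul (a : ℝ) {q : ℝ} (hq : |q| < 1) :
    qPochInf a q = (1 - a) * qPochInf (a * q) q := by
  refine tendsto_nhds_unique ((tendsto_add_atTop_iff_nat 1).mpr (tendsto_qPochFin a hq)) ?_
  simp only [qPochFin_succ']
  exact (tendsto_qPochFin (a * q) hq).const_mul _

theorem qPochFin_mul_qPochInf (a : ℝ) {q : ℝ} (hq : |q| < 1) (n : ℕ) :
    qPochFin a q n * qPochInf (a * q ^ n) q = qPochInf a q := by
  induction n with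
  | zero => simp [qPochFin]
  | succ n ih =>
    rw [← ih, qPochInf_eq_mul (a * q ^ n) hq, qPochFin_succ, pow_succ]
    ring_nf

theorem tendsto_qPochInf_mul_pow {a q : ℝ} (hq : |q| < 1) (ha : |a| < 1) :
    Tendsto (fun n : ℕ => qPochInf (a * q ^ n) q) atTop (𝓝 1) := by
  have h0 := qPochInf_ne_zero hq ha
  have h := (tendsto_qPochFin a hq).inv₀ h0 |>.mul_const (qPochInf a q)
  rw [inv_mul_cancel₀ h0] at h
  refine h.congr fun n => ?_
  rw [← qPochFin_mul_qPochInf a hq n, inv_mul_cancel_left₀ (qPochFin_ne_zero hq ha n)]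

theorem abs_qPochInf_le {a q : ℝ} (hq : |q| < 1) (ha : |a| ≤ 1) :
    |qPochInf a q| ≤ Real.exp (1 - |q|)⁻¹ := by
  refine le_of_tendsto (tendsto_qPochFin a hq).abs (Eventually.of_forall fun n => ?_)
  rw [qPochFin, Finset.abs_prod]
  calc ∏ j ∈ Finset.range n, |1 - a * q ^ j| ≤ ∏ j ∈ Finset.range n, (1 + |q| ^ j) := by
        refine Finset.prod_le_prod (fun _ _ => abs_nonneg _) fun j _ => ?_
        refine (abs_sub _ _).trans ?_
        rw [abs_one, abs_mul, abs_pow]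
        gcongr
        exact mul_le_of_le_one_left (by positivity) ha
    _ ≤ Real.exp (∑ j ∈ Finset.range n, |q| ^ j) :=
        Real.prod_one_add_le_exp_sum _ fun j => by positivity
    _ ≤ _ := by
        rw [← tsum_geometric_of_lt_one (abs_nonneg q) hq]
        gcongr
        exact (summable_geometric_of_lt_one (abs_nonneg q) hq).sum_le_tsum _
          fun j _ => by positivity

theorem exists_inv_qPochFin_le {a q : ℝ} (hq : |q| < 1) (ha : |a| < 1) :
    ∃ M : ℝ, 0 < M ∧ ∀ n, |(qPochFin a q n)⁻¹| ≤ M := by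
  obtain ⟨M, hM⟩ := ((tendsto_qPochFin a hq).inv₀ (qPochInf_ne_zero hq ha)).abs.bddAbove_range
  exact ⟨max M 1, by positivity, fun n => (hM ⟨n, rfl⟩).trans (le_max_left _ _)⟩

/-! ### Growth of the q-Hermite polynomials on [-1, 1] -/

theorem summable_succ_mul_pow {r : ℝ} (hr : |r| < 1) :
    Summable (fun n : ℕ => ((n : ℝ) + 1) * |r| ^ n) := by
  have hr' : ‖|r|‖ < 1 := by simpa using hr
  refine ((summable_pow_mul_geometric_of_norm_lt_one 1 hr').add
    (summable_geometric_of_norm_lt_one hr')).congr fun n => ?_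
  ring

/-- On `[-1, 1]` the continuous `q`-Hermite polynomials grow at most linearly in the degree. -/
theorem exists_abs_qHermiteCont_le {q y : ℝ} (hq : |q| < 1) (hy : |y| ≤ 1) :
    ∃ K : ℝ, 0 < K ∧ ∀ n : ℕ, |qHermiteCont q y n| ≤ K * (n + 1) := by
  set s := Real.sqrt (1 - y ^ 2)
  have hs : s ^ 2 = 1 - y ^ 2 := Real.sq_sqrt (by nlinarith [sq_abs y, abs_nonneg y])
  -- z and w are the roots of t² - 2yt + 1, both on the unit circle. They factor the q = 0 part of
  -- the recurrence: d_n = h_{n+1} - z h_n satisfies d_{n+1} = w d_n + q^(n+1) h_n. Bounding h_n and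
  -- d_n together costs a factor 1 + (n+1)|q|^(n+1) per step, and the product of these factors
  -- converges.
  set z : ℂ := ⟨y, s⟩
  set w : ℂ := ⟨y, -s⟩
  have hzw : w * z = 1 := by
    apply Complex.ext <;> simp [z, w] <;> nlinarith
  have hzs : z + w = 2 * (y : ℂ) := by
    apply Complex.ext <;> simp [z, w]
    ring
  have hz : ‖z‖ = 1 := by
    rw [Complex.norm_def, Complex.normSq_mk, Real.sqrt_eq_one]
    nlinarith
  have hw : ‖w‖ = 1 := by
    rw [Complex.norm_def, Complex.normSq_mk, Real.sqrt_eq_one]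
    nlinarith
  set K : ℕ → ℝ := fun n => ∏ j ∈ Finset.range n, (1 + ((j : ℝ) + 1) * |q| ^ (j + 1)) with hK
  have hKs : ∀ n, K (n + 1) = K n * (1 + ((n : ℝ) + 1) * |q| ^ (n + 1)) :=
    fun n => Finset.prod_range_succ _ _
  have hK0 : ∀ n, 0 ≤ K n := fun n => Finset.prod_nonneg fun j _ => by positivity
  have key : ∀ n : ℕ, ‖(qHermiteCont q y n : ℂ)‖ ≤ (n + 1) * K n ∧
      ‖(qHermiteCont q y (n + 1) : ℂ) - z * qHermiteCont q y n‖ ≤ K n := by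
    intro n
    induction n with
    | zero =>
      have : (2 * (y : ℂ)) - z = w := by rw [← hzs]; ring
      simp [qHermiteCont, K, this, hw]
    | succ n ih =>
      obtain ⟨h1, h2⟩ := ih
      have hle : K n ≤ K (n + 1) := by
        rw [hKs]
        exact le_mul_of_one_le_right (hK0 n) (le_add_of_nonneg_right (by positivity))
      constructor
      · have e : (qHermiteCont q y (n + 1) : ℂ) =
            ((qHermiteCont q y (n + 1) : ℂ) - z * qHermiteCont q y n) + z * qHermiteCont q y n := by
          ring
        rw [e]
        refine (norm_add_le _ _).trans ?_
        rw [norm_mul, hz, one_mul]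
        push_cast
        nlinarith
      · have e : (qHermiteCont q y (n + 1 + 1) : ℂ) - z * qHermiteCont q y (n + 1) =
            w * ((qHermiteCont q y (n + 1) : ℂ) - z * qHermiteCont q y n)
              + (q : ℂ) ^ (n + 1) * qHermiteCont q y n := by
          rw [qHermiteCont]
          push_cast
          linear_combination (-(qHermiteCont q y (n + 1) : ℂ)) * hzs
            + (qHermiteCont q y n : ℂ) * hzw
        rw [e]
        refine (norm_add_le _ _).trans ?_
        rw [norm_mul, hw, one_mul, norm_mul, norm_pow, Complex.norm_real, Real.norm_eq_abs q, hKs]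
        have := mul_le_mul_of_nonneg_left h1 (pow_nonneg (abs_nonneg q) (n + 1))
        linarith
  have hsum : Summable (fun j : ℕ => ((j : ℝ) + 1) * |q| ^ (j + 1)) :=
    ((summable_succ_mul_pow hq).mul_right |q|).congr fun j => by ring
  refine ⟨Real.exp (∑' j : ℕ, ((j : ℝ) + 1) * |q| ^ (j + 1)), Real.exp_pos _, fun n => ?_⟩
  have h1 := (key n).1
  rw [Complex.norm_real, Real.norm_eq_abs] at h1
  rw [mul_comm]
  refine h1.trans (mul_le_mul_of_nonneg_left ?_ (by positivity))
  refine (Real.prod_one_add_le_exp_sum _ fun j => by positivity).trans ?_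
  gcongr
  exact hsum.sum_le_tsum _ fun j _ => by positivity

/-! ### The even-degree series and its q-difference equation -/

/-- The terms of the even-degree `q`-Hermite series, in the variable `y = x √(1-q) / 2`. -/
noncomputable def evenTerm (q y a : ℝ) (k : ℕ) : ℝ :=
  a ^ k * qPochInf (a * q ^ (k + 1)) q * (qPochFin q q k)⁻¹ * qHermiteCont q y (2 * k)

theorem abs_mul_pow_le_one {a q : ℝ} (hq : |q| < 1) (ha : |a| ≤ 1) (n : ℕ) : |a * q ^ n| ≤ 1 :=
  (abs_mul_pow_le hq a n).trans ha

/-- Leaving b free and allowing m = k + 1 lets one constant serve both the terms of the series and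
the two halves of `evenBoundary`, uniformly in a. -/
theorem exists_abs_pow_mul_le {q y : ℝ} (hq : |q| < 1) (hy : |y| ≤ 1) :
    ∃ C : ℝ, 0 < C ∧ ∀ b : ℝ, |b| ≤ 1 → ∀ a : ℝ, ∀ k m : ℕ, m ≤ k + 1 →
      |a ^ k * qPochInf b q * (qPochFin q q k)⁻¹ * qHermiteCont q y (2 * m)|
        ≤ C * ((k + 1) * |a| ^ k) := by
  obtain ⟨M, hM0, hM⟩ := exists_inv_qPochFin_le hq hq
  obtain ⟨K, hK0, hK⟩ := exists_abs_qHermiteCont_le hq hy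
  -- The 3 comes from 2m + 1 ≤ 2k + 3 ≤ 3(k + 1).
  refine ⟨Real.exp (1 - |q|)⁻¹ * M * (K * 3), by positivity, fun b hb a k m hm => ?_⟩
  rw [abs_mul, abs_mul, abs_mul, abs_pow]
  have hm' : (m : ℝ) ≤ k + 1 := by exact_mod_cast hm
  have hh : |qHermiteCont q y (2 * m)| ≤ K * (3 * (k + 1)) := by
    refine (hK (2 * m)).trans (mul_le_mul_of_nonneg_left ?_ hK0.le)
    push_cast
    have : (0 : ℝ) ≤ k := k.cast_nonneg
    linarith
  calc |a| ^ k * |qPochInf b q| * |(qPochFin q q k)⁻¹| * |qHermiteCont q y (2 * m)|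
      ≤ |a| ^ k * Real.exp (1 - |q|)⁻¹ * M * (K * (3 * (k + 1))) := by
        gcongr
        · exact abs_qPochInf_le hq hb
        · exact hM k
    _ = _ := by ring

theorem exists_abs_evenTerm_le {q y : ℝ} (hq : |q| < 1) (hy : |y| ≤ 1) :
    ∃ C : ℝ, 0 < C ∧ ∀ a : ℝ, |a| ≤ 1 → ∀ k : ℕ,
      |evenTerm q y a k| ≤ C * ((k + 1) * |a| ^ k) := by
  obtain ⟨C, hC0, hC⟩ := exists_abs_pow_mul_le hq hy
  exact ⟨C, hC0, fun a ha k => hC _ (abs_mul_pow_le_one hq ha _) a k k (Nat.le_succ k)⟩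

theorem summable_evenTerm {q y a : ℝ} (hq : |q| < 1) (hy : |y| ≤ 1) (ha : |a| < 1) :
    Summable (evenTerm q y a) := by
  obtain ⟨C, -, hC⟩ := exists_abs_evenTerm_le hq hy
  exact ((summable_succ_mul_pow ha).mul_left C).of_norm_bounded (hC a ha.le)

/-- The boundary term in the `q`-difference equation for the partial sums. -/
noncomputable def evenBoundary (q y a : ℝ) (k : ℕ) : ℝ :=
  a ^ (k + 2) * qPochInf (a * q ^ (k + 2)) q * (1 + q ^ (k + 1)) * (1 - q ^ (2 * k + 1))
      * (qPochFin q q k)⁻¹ * qHermiteCont q y (2 * k)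
    - a ^ (k + 1) * qPochInf (a * q ^ (k + 1)) q * (qPochFin q q k)⁻¹
      * qHermiteCont q y (2 * (k + 1))

theorem tendsto_evenBoundary {q y a : ℝ} (hq : |q| < 1) (hy : |y| ≤ 1) (ha : |a| < 1) :
    Tendsto (evenBoundary q y a) atTop (𝓝 0) := by
  obtain ⟨C, hC0, hC⟩ := exists_abs_pow_mul_le hq hy
  -- 5 = 2·2 + 1: two factors of size at most 2 in front of X, and one copy of Y.
  have h0 := ((summable_succ_mul_pow ha).mul_left (5 * C)).tendsto_atTop_zero
  refine squeeze_zero_norm (fun k => ?_) h0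
  have h1 := hC _ (abs_mul_pow_le_one hq ha.le (k + 2)) a k k (Nat.le_succ k)
  have h2 := hC _ (abs_mul_pow_le_one hq ha.le (k + 1)) a k (k + 1) le_rfl
  set X := a ^ k * qPochInf (a * q ^ (k + 2)) q * (qPochFin q q k)⁻¹ * qHermiteCont q y (2 * k)
  set Y := a ^ k * qPochInf (a * q ^ (k + 1)) q * (qPochFin q q k)⁻¹
    * qHermiteCont q y (2 * (k + 1))
  have e : evenBoundary q y a k =
      a ^ 2 * ((1 + q ^ (k + 1)) * (1 - q ^ (2 * k + 1))) * X - a * Y := by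
    simp only [evenBoundary, X, Y]
    ring
  have hqn : ∀ n, |q ^ n| ≤ 1 := fun n => by
    rw [abs_pow]; exact pow_le_one₀ (abs_nonneg q) hq.le
  have b1 : |1 + q ^ (k + 1)| ≤ 2 := (abs_add_le _ _).trans (by rw [abs_one]; linarith [hqn (k + 1)])
  have b2 : |1 - q ^ (2 * k + 1)| ≤ 2 :=
    (abs_sub _ _).trans (by rw [abs_one]; linarith [hqn (2 * k + 1)])
  rw [e, Real.norm_eq_abs]
  calc |a ^ 2 * ((1 + q ^ (k + 1)) * (1 - q ^ (2 * k + 1))) * X - a * Y|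
      ≤ |a| ^ 2 * (|1 + q ^ (k + 1)| * |1 - q ^ (2 * k + 1)|) * |X| + |a| * |Y| := by
        refine (abs_sub _ _).trans ?_
        simp only [abs_mul, abs_pow, le_refl]
    _ ≤ 1 * (2 * 2) * (C * ((k + 1) * |a| ^ k)) + 1 * (C * ((k + 1) * |a| ^ k)) := by
        gcongr
        exact pow_le_one₀ (abs_nonneg a) ha.le
    _ = _ := by ring

/-- The difference equation telescopes: the k-th terms of its two sides differ by an increment of
`evenBoundary`. In the induction step everything is expressed through h_{2n}, h_{2n+1}, (q)_n and
(aq^(n+3))_∞, which leaves a rational identity. -/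
theorem lFactor_mul_sum_evenTerm {q : ℝ} (y a : ℝ) (hq : |q| < 1) (n : ℕ) :
    lFactor y a * ∑ k ∈ Finset.range (n + 1), evenTerm q y a k =
      (1 + a) * (1 - q * a ^ 2) * ∑ k ∈ Finset.range (n + 1), evenTerm q y (a * q) k
        + evenBoundary q y a n := by
  have shift : ∀ n : ℕ, qPochInf (a * q ^ n) q = (1 - a * q ^ n) * qPochInf (a * q ^ (n + 1)) q :=
    fun n => by rw [qPochInf_eq_mul _ hq, pow_succ, mul_assoc]
  induction n with
  | zero =>
    have e : a * q * q ^ (0 + 1) = a * q ^ 2 := by ring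
    simp only [zero_add, Finset.sum_range_one, evenTerm, evenBoundary, lFactor, qPochFin,
      Finset.range_zero, Finset.prod_empty, mul_zero, mul_one, qHermiteCont, e, shift 1]
    ring
  | succ n ih =>
    rw [Finset.sum_range_succ _ (n + 1), Finset.sum_range_succ _ (n + 1), mul_add, ih]
    have hD := qPochFin_ne_zero hq hq n
    have hD1 : 1 - q * q ^ n ≠ 0 := one_sub_ne_zero_of_abs_lt_one (abs_mul_pow_lt_one hq hq n)
    have r2 : qHermiteCont q y (2 * (n + 1)) = 2 * y * qHermiteCont q y (2 * n + 1)
        - (1 - q ^ (2 * n + 1)) * qHermiteCont q y (2 * n) := rfl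
    have r3 : qHermiteCont q y (2 * n + 3) = 2 * y * qHermiteCont q y (2 * (n + 1))
        - (1 - q ^ (2 * n + 2)) * qHermiteCont q y (2 * n + 1) := rfl
    have r4 : qHermiteCont q y (2 * (n + 1 + 1)) = 2 * y * qHermiteCont q y (2 * n + 3)
        - (1 - q ^ (2 * n + 3)) * qHermiteCont q y (2 * (n + 1)) := rfl
    have e : a * q * q ^ (n + 1 + 1) = a * q ^ (n + 3) := by ring
    simp only [evenTerm, evenBoundary, lFactor, qPochFin_succ, e, r4, r3, r2]
    rw [show n + 1 + 1 = n + 2 from rfl, show n + 1 + 2 = n + 3 from rfl, shift (n + 1),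
      show n + 1 + 1 = n + 2 from rfl, shift (n + 2)]
    generalize qPochInf (a * q ^ (n + 2 + 1)) q = P
    generalize qHermiteCont q y (2 * n + 1) = h1
    generalize qHermiteCont q y (2 * n) = h0
    generalize qPochFin q q n = D at hD
    rw [mul_inv]
    field_simp
    ring

/-- The `q`-difference equation satisfied by the even-degree `q`-Hermite series. -/
theorem lFactor_mul_tsum_evenTerm {q y a : ℝ} (hq : |q| < 1) (hy : |y| ≤ 1) (ha : |a| < 1) :
    lFactor y a * ∑' k, evenTerm q y a k =
      (1 + a) * (1 - q * a ^ 2) * ∑' k, evenTerm q y (a * q) k := by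
  have haq : |a * q| < 1 := by simpa using abs_mul_pow_lt_one hq ha 1
  have h1 := ((tendsto_add_atTop_iff_nat 1).mpr
    (summable_evenTerm hq hy ha).hasSum.tendsto_sum_nat).const_mul (lFactor y a)
  have h2 := (((tendsto_add_atTop_iff_nat 1).mpr
    (summable_evenTerm hq hy haq).hasSum.tendsto_sum_nat).const_mul
      ((1 + a) * (1 - q * a ^ 2))).add (tendsto_evenBoundary hq hy ha)
  rw [add_zero] at h2
  exact tendsto_nhds_unique h1 (h2.congr fun n => (lFactor_mul_sum_evenTerm y a hq n).symm)

/-! ### Iteration and the limit -/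

theorem prod_lFactor_mul_tsum_evenTerm {q y a : ℝ} (hq : |q| < 1) (hy : |y| ≤ 1) (ha : |a| < 1)
    (n : ℕ) :
    qPochFin a q n * ((∏ k ∈ Finset.range n, lFactor y (a * q ^ k)) * ∑' k, evenTerm q y a k) =
      qPochFin (a ^ 2) q (2 * n) * ∑' k, evenTerm q y (a * q ^ n) k := by
  induction n with
  | zero => simp [qPochFin]
  | succ n ih =>
    have h := lFactor_mul_tsum_evenTerm hq hy (abs_mul_pow_lt_one hq ha n)
    rw [mul_assoc a, ← pow_succ] at h
    rw [show 2 * (n + 1) = 2 * n + 1 + 1 from rfl, qPochFin_succ, qPochFin_succ, qPochFin_succ,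
      Finset.prod_range_succ]
    -- With b = aq^n, (1-b)(1+b)(1-qb²) = (1-b²)(1-qb²) supplies the next two factors of
    -- (a²)_{2n+2}. Multiplying by (a)_n avoids dividing.
    linear_combination (1 - a * q ^ n) * lFactor y (a * q ^ n) * ih
      + (1 - a * q ^ n) * qPochFin (a ^ 2) q (2 * n) * h

/-- Dominated convergence with bound C(k+1)|a|^k, independent of n: only k = 0 survives,
contributing (aq^(n+1))_∞ → 1. -/
theorem tendsto_tsum_evenTerm {q y a : ℝ} (hq : |q| < 1) (hy : |y| ≤ 1) (ha : |a| < 1) :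
    Tendsto (fun n : ℕ => ∑' k, evenTerm q y (a * q ^ n) k) atTop (𝓝 1) := by
  obtain ⟨C, hC0, hC⟩ := exists_abs_evenTerm_le hq hy
  have h := tendsto_tsum_of_dominated_convergence (𝓕 := atTop)
    (f := fun (n : ℕ) k => evenTerm q y (a * q ^ n) k) (g := fun k : ℕ => if k = 0 then (1 : ℝ) else 0)
    ((summable_succ_mul_pow ha).mul_left C) ?_ (Eventually.of_forall fun n k => ?_)
  · simpa using h
  · intro k
    by_cases hk : k = 0
    · subst hk
      have := (tendsto_add_atTop_iff_nat 1).mpr (tendsto_qPochInf_mul_pow hq ha)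
      refine (this.congr fun n => ?_).trans (by simp)
      simp [evenTerm, qPochFin, qHermiteCont, pow_succ, mul_assoc]
    · simp only [hk, if_false]
      have h0 : Tendsto (fun n : ℕ => |a * q ^ n| ^ k) atTop (𝓝 0) := by
        have := (((tendsto_pow_atTop_nhds_zero_of_abs_lt_one hq).const_mul a).abs.pow k)
        simpa [hk] using this
      refine squeeze_zero_norm (fun n => hC _ (abs_mul_pow_lt_one hq ha n).le k) ?_
      simpa using (h0.const_mul ((k : ℝ) + 1)).const_mul C
  · refine (hC _ (abs_mul_pow_lt_one hq ha n).le k).trans ?_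
    have := abs_mul_pow_le hq a n
    gcongr

theorem lFactor_pos {y a : ℝ} (hy : |y| ≤ 1) (ha : |a| < 1) : 0 < lFactor y a := by
  obtain ⟨h1, h2⟩ := abs_lt.mp ha
  have hy2 : y ^ 2 ≤ 1 := by nlinarith [sq_abs y, abs_nonneg y]
  -- A convex combination of (1-a)² and (1+a)², both positive for |a| < 1.
  have e : lFactor y a = y ^ 2 * (1 - a) ^ 2 + (1 - y ^ 2) * (1 + a) ^ 2 := by
    rw [lFactor]; ring
  rcases eq_or_ne y 0 with rfl | h
  · rw [e]
    nlinarith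
  · rw [e]
    have : 0 < y ^ 2 := by positivity
    exact add_pos_of_pos_of_nonneg (mul_pos this (pow_pos (by linarith) 2))
      (mul_nonneg (by linarith) (sq_nonneg _))

theorem summable_norm_lFactor_sub_one (y a : ℝ) {q : ℝ} (hq : |q| < 1) :
    Summable (fun k : ℕ => ‖lFactor y (a * q ^ k) - 1‖) := by
  refine ((summable_abs_mul_pow a hq).mul_left (|2 - 4 * y ^ 2| + |a|)).of_nonneg_of_le
    (fun _ => norm_nonneg _) fun k => ?_
  have e : lFactor y (a * q ^ k) - 1 = (2 - 4 * y ^ 2 + a * q ^ k) * (a * q ^ k) := by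
    rw [lFactor]; ring
  rw [e, Real.norm_eq_abs, abs_mul]
  gcongr
  refine (abs_add_le _ _).trans ?_
  exact add_le_add_right (abs_mul_pow_le hq a k) _

theorem multipliable_lFactor (y a : ℝ) {q : ℝ} (hq : |q| < 1) :
    Multipliable (fun k : ℕ => lFactor y (a * q ^ k)) := by
  simpa using multipliable_one_add_of_summable (summable_norm_lFactor_sub_one y a hq)

theorem tprod_lFactor_ne_zero {q y a : ℝ} (hq : |q| < 1) (hy : |y| ≤ 1) (ha : |a| < 1) :
    ∏' k : ℕ, lFactor y (a * q ^ k) ≠ 0 := by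
  have h := tprod_one_add_ne_zero_of_summable (f := fun k : ℕ => lFactor y (a * q ^ k) - 1)
    (fun k => by simpa using (lFactor_pos hy (abs_mul_pow_lt_one hq ha k)).ne')
    (summable_norm_lFactor_sub_one y a hq)
  simpa using h

theorem tsum_evenTerm {q y a : ℝ} (hq : |q| < 1) (hy : |y| ≤ 1) (ha : |a| < 1) :
    ∑' k, evenTerm q y a k =
      qPochInf (a ^ 2) q / qPochInf a q * (∏' k : ℕ, lFactor y (a * q ^ k))⁻¹ := by
  have h1 := (tendsto_qPochFin a hq).mul
    ((multipliable_lFactor y a hq).hasProd.tendsto_prod_nat.mul_const (∑' k, evenTerm q y a k))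
  have h2 := ((tendsto_qPochFin (a ^ 2) hq).comp
    (tendsto_id.const_mul_atTop' (r := 2) two_pos)).mul (tendsto_tsum_evenTerm hq hy ha)
  have h := tendsto_nhds_unique h1
    (h2.congr fun n => (prod_lFactor_mul_tsum_evenTerm hq hy ha n).symm)
  have hP := qPochInf_ne_zero hq ha
  have hL := tprod_lFactor_ne_zero hq hy ha
  field_simp
  linear_combination h

/-! ### Return to the rescaled polynomials -/

theorem abs_le_one_of_mem_supportS {q x : ℝ} (hq : q < 1) (hx : x ∈ supportS q) :
    |x * Real.sqrt (1 - q) / 2| ≤ 1 := by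
  have hs : 0 < Real.sqrt (1 - q) := Real.sqrt_pos.mpr (by linarith)
  obtain ⟨h1, h2⟩ := hx
  rw [div_le_iff₀ hs] at h1
  rw [le_div_iff₀ hs] at h2
  exact abs_le.mpr ⟨by linarith, by linarith⟩

theorem qFact_mul_pow (q : ℝ) (n : ℕ) : qFact q n * (1 - q) ^ n = qPochFin q q n := by
  induction n with
  | zero => simp [qFact, qPochFin]
  | succ n ih =>
    have h : qNumber q (n + 1) * (1 - q) = 1 - q * q ^ n := by
      rw [qNumber, geom_sum_mul_neg, pow_succ']
    rw [qPochFin_succ, ← ih, ← h, qFact, Finset.prod_range_succ, ← qFact]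
    ring

theorem qHermite_two_mul {q : ℝ} (hq : q < 1) (x : ℝ) (k : ℕ) :
    qHermite q (2 * k) x = ((1 - q) ^ k)⁻¹ * qHermiteCont q (x * Real.sqrt (1 - q) / 2) (2 * k) := by
  -- Even degree makes the exponent an integer; the resulting (1-q)^(-k) is the factor that turns
  -- 1/[k]_q! into 1/(q)_k.
  have e : -((2 * k : ℕ) : ℝ) / 2 = -(k : ℝ) := by push_cast; ring
  rw [qHermite, e, Real.rpow_neg (by linarith), Real.rpow_natCast]

/-- The sum along the diagonal in terms of `q`-Hermite polynomials of even degree. The first three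
conjuncts say that the right-hand side of the identity is meaningful: no divisor vanishes and the
infinite product converges; the last says that the series converges and has the asserted sum. -/
theorem mainTheorem4 (q ρ x : ℝ) (hq : |q| < 1) (hρ : |ρ| < 1) (hx : x ∈ supportS q) :
    qPochInf ρ q ≠ 0 ∧
    (∀ k : ℕ, LFactor q x (ρ * q ^ k) ≠ 0) ∧
    Multipliable (fun k : ℕ => (LFactor q x (ρ * q ^ k))⁻¹) ∧
    HasSum
      (fun k : ℕ => ρ ^ k * qPochInf (ρ * q ^ (k + 1)) q / qFact q k * qHermite q (2 * k) x)
      (qPochInf (ρ ^ 2) q / qPochInf ρ q * ∏' k : ℕ, (LFactor q x (ρ * q ^ k))⁻¹) := by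
  have hq1 : q < 1 := (abs_lt.mp hq).2
  have hy := abs_le_one_of_mem_supportS hq1 hx
  have hL := tprod_lFactor_ne_zero hq hy hρ
  have hM := multipliable_lFactor (x * Real.sqrt (1 - q) / 2) ρ hq
  refine ⟨qPochInf_ne_zero hq hρ, fun k => (lFactor_pos hy (abs_mul_pow_lt_one hq hρ k)).ne',
    hM.inv₀ hL, ?_⟩
  have hs := (summable_evenTerm hq hy hρ).hasSum
  rw [tsum_evenTerm hq hy hρ, ← (hM.hasProd.inv₀ hL).tprod_eq] at hs
  refine hs.congr_fun fun k => ?_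
  rw [evenTerm, qHermite_two_mul hq1, ← qFact_mul_pow, mul_inv]
  ring
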